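/- Let $k_1,k_2,k_3\ge 0$ be integers and $L=\mathbb Z[x_1^{\pm1},x_2^{\pm1},x_3^{\pm1}]$. **Clusters.** Let $\mathcal A(k_1,k_2,k_3)$ be the rank-three generalized cluster algebra with trivial coefficients ($\mathbb P=\{1\}$) whose initial seed has cluster $(x_1,x_2,x_3)$, exchange polynomials $Z_i(u)=1+u$ if $k_i=0$ and $Z_i(u)=1+k_iu+u^2$ if $k_i\neq0$, and exchange matrix obtained from $\begin{bmatrix}0&-1&1\\1&0&-1\\-1&1&0\end{bmatrix}$ by doubling the $j$-th column for each $j$ with $k_j=0$. (Its mutation in direction $i$ replaces the $i$-th entry $a_i$ of a labeled cluster $(a_1,a_2,a_3)$ by $(a_j^2+k_ia_ja_h+a_h^2)/a_i$, where $\{i,j,h\}=\{1,2,3\}$.) A non-labeled cluster is a triple $(a,b,c)$ obtained by permuting the entries of a labeled cluster. The parity of a cluster variable $v$ is $k_v:=k_i$, where $i$ is the position of $v$ in the labeled clusters that contain it. For a cluster variable $v$ (which lies in $L$), $|v|$ denotes its value at $x_1=x_2=x_3=1$. **CMM triples.** A $(k_1,k_2,k_3)$-cluster Markov-monodromy (CMM)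 matrix is a matrix $X\in SL(2,L)$ whose $(1,2)$-entry $x_{12}$ is a cluster variable of $\mathcal A(k_1,k_2,k_3)$ and with $\operatorname{tr}X=-k_{x_{12}}$. A CMM triple associated with $(a,b,c)$ is a triple $(X,Y,Z)$ of CMM matrices with $(1,2)$-entries $a,b,c$ respectively, such that $(a,b,c)$ is a non-labeled cluster and $$XYZ=\begin{bmatrix}-1&0\\ \mathscr M&-1\end{bmatrix},\qquad \mathscr M=\frac{x_1^2+x_2^2+x_3^2+k_1x_2x_3+k_2x_1x_3+k_3x_1x_2}{x_1x_2x_3}.$$ **Trees.** For $\sigma\in\mathfrak S_3$ and $f\in L$, write $y_i=x_{\sigma(i)}$, $\kappa_i=k_{\sigma(i)}$, and let $$X_\sigma(f)=\begin{bmatrix}f&y_1\\ *&-f-\kappa_1\end{bmatrix},\quad Y_\sigma(f)=\begin{bmatrix}\frac{fy_2-\kappa_2y_1-y_3}{y_1}&y_2\\ *&\frac{-fy_2+y_3}{y_1}\end{bmatrix},$$ $$Z_\sigma(f)=\begin{bmatrix}\frac{fy_2y_3-\kappa_3y_1y_2-\kappa_2y_1y_3-y_1^2-y_3^2}{y_1y_2}&y_3\\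 *&\frac{-fy_2y_3+\kappa_2y_1y_3+y_1^2+y_3^2}{y_1y_2}\end{bmatrix},$$ where the $(2,1)$-entries are determined by the determinants being $1$. The tree $\mathrm{CMM}\mathbb T(k_1,k_2,k_3,\sigma,f)$ is the infinite planar binary tree whose root is $(X_\tau(f),\,Y_\tau(f)Z_\tau(f)Y_\tau(f)^{-1},\,Y_\tau(f))$ with $\tau=\sigma\circ(2\ 3)$, and in which a vertex $(X,Y,Z)$ has left child $(X,YZY^{-1},Y)$ and right child $(Y,Y^{-1}XY,Z)$. **Theorem.** Let $(X,Y,Z)$ be a $(k_1,k_2,k_3)$-CMM triple associated with $(a,b,c)$, and assume $|b|>\max\{|a|,|c|\}$. Then there exist a unique $f\in L$, a unique $\sigma\in\mathfrak S_3$ and a unique vertex $v$ of $\mathrm{CMM}\mathbb T(k_1,k_2,k_3,\sigma,f)$ such that $v=(X,Y,Z)$; that is, exactly one triple $(f,\sigma,v)$, consisting of $f\in L$, $\sigma\in\mathfrak S_3$ and a position $v$ in the infinite binary tree, is such that $(X,Y,Z)$ sits at position $v$ of $\mathrm{CMM}\mathbb T(k_1,k_2,k_3,\sigma,f)$. -/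

import Mathlib

namespace CMM

/-- The Laurent polynomial ring `ℤ[x₁^{±1}, x₂^{±1}, x₃^{±1}]`: finite formal `ℤ`-linear
combinations of monomials with exponent vectors in `ℤ³`. The three variables are indexed by
`0, 1, 2 : Fin 3`. -/
abbrev Laurent : Type := AddMonoidAlgebra ℤ (Fin 3 → ℤ)

/-- The ambient field `ℚ(x₁, x₂, x₃)`, the fraction field of the Laurent polynomial ring. -/
abbrev RatFun : Type := FractionRing Laurent

/-- The variable `x_i`. -/
noncomputable def x (i : Fin 3) : Laurent := AddMonoidAlgebra.single (Pi.single i 1) 1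

/-- The Laurent monomial `x_i⁻¹`. -/
noncomputable def xinv (i : Fin 3) : Laurent := AddMonoidAlgebra.single (Pi.single i (-1)) 1

theorem x_mul_xinv (i : Fin 3) : x i * xinv i = 1 := by
  rw [x, xinv, AddMonoidAlgebra.single_mul_single, ← Pi.single_add]
  simp [AddMonoidAlgebra.one_def]

/-- The size `|a|`: the value of a Laurent polynomial at `x₁ = x₂ = x₃ = 1`. -/
noncomputable def size : Laurent →ₐ[ℤ] ℤ :=
  AddMonoidAlgebra.lift ℤ ℤ (Fin 3 → ℤ) 1

/-! ### Generalized cluster patterns of rank three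

Only the coefficient semifield `ℙ = {1}` is needed. Then the coefficient tuple is `(1, 1, 1)`
throughout, `ℤℙ = ℤ`, and the evaluation of an exchange polynomial in `ℙ` is `1`; so a seed
consists of a cluster, an exchange matrix and the exchange polynomials. -/

/-- A labeled seed (with trivial coefficients). -/
structure Seed where
  /-- the labeled cluster -/
  cluster : Fin 3 → RatFun
  /-- the exchange matrix -/
  B : Matrix (Fin 3) (Fin 3) ℤ
  /-- the exchange polynomials, with coefficients in `ℤ_{≥0}` -/
  Z : Fin 3 → Polynomial ℕ

/-- The degree `d_i` of the `i`-th exchange polynomial. -/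
noncomputable def Seed.d (s : Seed) (i : Fin 3) : ℕ := (s.Z i).natDegree

/-- Seed mutation in direction `k`. Here `Int.toNat b = max b 0`. Exchange polynomials have
constant term `1`, so `Polynomial.reverse` sends `Z(u)` to `u ^ deg Z * Z(u⁻¹)`. -/
noncomputable def Seed.mutate (s : Seed) (k : Fin 3) : Seed where
  cluster := Function.update s.cluster k
    ((s.cluster k)⁻¹ * (∏ i, s.cluster i ^ (-s.B i k).toNat) ^ s.d k *
      Polynomial.aeval (∏ i, s.cluster i ^ s.B i k) (s.Z k))
  B := Matrix.of fun i j =>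
    if i = k ∨ j = k then -s.B i j
    else s.B i j + s.d k * (max (s.B i k) 0 * s.B k j + s.B i k * max (-s.B k j) 0)
  Z := Function.update s.Z k (s.Z k).reverse

/-- The exchange polynomial `1 + u` if `κ = 0`, and `1 + κ u + u²` otherwise. -/
noncomputable def exchangePoly (κ : ℕ) : Polynomial ℕ :=
  if κ = 0 then 1 + Polynomial.X
  else 1 + Polynomial.C κ * Polynomial.X + Polynomial.X ^ 2

/-- The initial exchange matrix of `𝒜(k₁, k₂, k₃)`: the matrix
`(0, -1, 1; 1, 0, -1; -1, 1, 0)` in which the `j`-th column is multiplied by `2` whenever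
`k_j = 0`. -/
def initialB (k : Fin 3 → ℕ) : Matrix (Fin 3) (Fin 3) ℤ :=
  Matrix.of fun i j =>
    (if k j = 0 then 2 else 1) * (!![0, -1, 1; 1, 0, -1; -1, 1, 0] : Matrix (Fin 3) (Fin 3) ℤ) i j

/-- The initial seed of the generalized Markov cluster algebra `𝒜(k₁, k₂, k₃)`. -/
noncomputable def initialSeed (k : Fin 3 → ℕ) : Seed where
  cluster := fun i => algebraMap Laurent RatFun (x i)
  B := initialB k
  Z := fun i => exchangePoly (k i)

/-- The seeds of `𝒜(k₁, k₂, k₃)`: those obtained from the initial seed by finitely many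
mutations. -/
inductive IsSeed (k : Fin 3 → ℕ) : Seed → Prop
  | init : IsSeed k (initialSeed k)
  | mutate (s : Seed) (i : Fin 3) : IsSeed k s → IsSeed k (s.mutate i)

/-- `v` is a cluster variable of `𝒜(k₁, k₂, k₃)` that appears in position `i` of a labeled
cluster. -/
def IsClusterVariableAt (k : Fin 3 → ℕ) (v : RatFun) (i : Fin 3) : Prop :=
  ∃ s, IsSeed k s ∧ s.cluster i = v

/-- `v` is a cluster variable of `𝒜(k₁, k₂, k₃)`. -/
def IsClusterVariable (k : Fin 3 → ℕ) (v : RatFun) : Prop :=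
  ∃ i, IsClusterVariableAt k v i

/-- `κ` is the parity `k_v` of the cluster variable `v`: it is `k_i`, where `i` is the position
of `v` in the labeled clusters that contain it. -/
def HasParity (k : Fin 3 → ℕ) (v : RatFun) (κ : ℕ) : Prop :=
  ∃ i, IsClusterVariableAt k v i ∧ κ = k i

/-- `(v 0, v 1, v 2)` is a non-labeled cluster of `𝒜(k₁, k₂, k₃)`: a permutation of a labeled
cluster. -/
def IsNonlabeledCluster (k : Fin 3 → ℕ) (v : Fin 3 → RatFun) : Prop :=
  ∃ s, IsSeed k s ∧ ∃ τ : Equiv.Perm (Fin 3), v = s.cluster ∘ τ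

/-- The generalized Markov invariant
`(x₁² + x₂² + x₃² + k₁ x₂ x₃ + k₂ x₁ x₃ + k₃ x₁ x₂) / (x₁ x₂ x₃)`. -/
noncomputable def markovInvariant (k : Fin 3 → ℕ) : Laurent :=
  (x 0 ^ 2 + x 1 ^ 2 + x 2 ^ 2 +
    k 0 * x 1 * x 2 + k 1 * x 0 * x 2 + k 2 * x 0 * x 1) * (xinv 0 * xinv 1 * xinv 2)

/-! ### Cluster Markov-monodromy matrices and triples -/

/-- The group `SL(2, ℤ[x₁^{±1}, x₂^{±1}, x₃^{±1}])`. -/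
abbrev SL2 : Type := Matrix.SpecialLinearGroup (Fin 2) Laurent

/-- A `(k₁, k₂, k₃)`-cluster Markov-monodromy matrix: an element of `SL2` whose `(1,2)`-entry is
a cluster variable and whose trace is minus the parity of that cluster variable. -/
def IsCMMMatrix (k : Fin 3 → ℕ) (X : SL2) : Prop :=
  IsClusterVariable k (algebraMap Laurent RatFun (X 0 1)) ∧
  ∃ κ : ℕ, HasParity k (algebraMap Laurent RatFun (X 0 1)) κ ∧
    X.val.trace = -(κ : Laurent)

/-- The matrix `T`. -/
noncomputable def T (k : Fin 3 → ℕ) : Matrix (Fin 2) (Fin 2) Laurent :=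
  !![-1, 0; markovInvariant k, -1]

/-- A `(k₁, k₂, k₃)`-cluster Markov-monodromy triple. -/
structure IsCMMTriple (k : Fin 3 → ℕ) (X Y Z : SL2) : Prop where
  left : IsCMMMatrix k X
  middle : IsCMMMatrix k Y
  right : IsCMMMatrix k Z
  prod_eq : X.val * Y.val * Z.val = T k
  cluster : IsNonlabeledCluster k
    ![algebraMap Laurent RatFun (X 0 1), algebraMap Laurent RatFun (Y 0 1),
      algebraMap Laurent RatFun (Z 0 1)]

/-- The triple `(X, Y, Z)` of matrices is associated with `(a, b, c)`. -/
def IsAssociated (X Y Z : SL2) (a b c : Laurent) : Prop :=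
  X 0 1 = a ∧ Y 0 1 = b ∧ Z 0 1 = c

/-! ### The trees -/

/-- The matrix `(p, x_i; *, q)`, whose `(2,1)`-entry is determined by the determinant being
`1`. -/
noncomputable def matOf (p : Laurent) (i : Fin 3) (q : Laurent) : SL2 :=
  ⟨!![p, x i; (p * q - 1) * xinv i, q], by
    rw [Matrix.det_fin_two_of]
    linear_combination (1 - p * q) * x_mul_xinv i⟩

/-- The matrix `X_σ(f)`. -/
noncomputable def X (k : Fin 3 → ℕ) (σ : Equiv.Perm (Fin 3)) (f : Laurent) : SL2 :=
  matOf f (σ 0) (-f - k (σ 0))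

/-- The matrix `Y_σ(f)`. -/
noncomputable def Y (k : Fin 3 → ℕ) (σ : Equiv.Perm (Fin 3)) (f : Laurent) : SL2 :=
  matOf ((f * x (σ 1) - k (σ 1) * x (σ 0) - x (σ 2)) * xinv (σ 0)) (σ 1)
    ((-f * x (σ 1) + x (σ 2)) * xinv (σ 0))

/-- The matrix `Z_σ(f)`. -/
noncomputable def Z (k : Fin 3 → ℕ) (σ : Equiv.Perm (Fin 3)) (f : Laurent) : SL2 :=
  matOf
    ((f * x (σ 1) * x (σ 2) - k (σ 2) * x (σ 0) * x (σ 1) - k (σ 1) * x (σ 0) * x (σ 2)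
        - x (σ 0) ^ 2 - x (σ 2) ^ 2) * (xinv (σ 0) * xinv (σ 1)))
    (σ 2)
    ((-f * x (σ 1) * x (σ 2) + k (σ 1) * x (σ 0) * x (σ 2) + x (σ 0) ^ 2 + x (σ 2) ^ 2)
      * (xinv (σ 0) * xinv (σ 1)))

/-- The root of the tree `CMM𝕋(k₁, k₂, k₃, σ, f)`; the transposition `(2 3)` of `{1, 2, 3}` is
`Equiv.swap 1 2` on `Fin 3`. -/
noncomputable def root (k : Fin 3 → ℕ) (σ : Equiv.Perm (Fin 3)) (f : Laurent) :
    SL2 × SL2 × SL2 :=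
  let τ := σ * Equiv.swap 1 2
  (X k τ f, Y k τ f * Z k τ f * (Y k τ f)⁻¹, Y k τ f)

/-- The two directions in a planar binary tree. -/
inductive Direction
  | left
  | right

/-- The left child `(X, Y Z Y⁻¹, Y)` and the right child `(Y, Y⁻¹ X Y, Z)` of `(X, Y, Z)`. -/
noncomputable def child : Direction → SL2 × SL2 × SL2 → SL2 × SL2 × SL2
  | .left, (X, Y, Z) => (X, Y * Z * Y⁻¹, Y)
  | .right, (X, Y, Z) => (Y, Y⁻¹ * X * Y, Z)

/-- The tree `CMM𝕋(k₁, k₂, k₃, σ, f)`. The vertices of the infinite planar binary tree are the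
finite words in the two directions: the root is `[]`, and `d :: v` is the child of `v` in the
direction `d`. The value at a vertex is the triple that sits there. -/
noncomputable def tree (k : Fin 3 → ℕ) (σ : Equiv.Perm (Fin 3)) (f : Laurent) :
    List Direction → SL2 × SL2 × SL2
  | [] => root k σ f
  | d :: v => child d (tree k σ f v)

end CMM

/-! Clusters. Every cluster solves one Markov equation, a quadratic in each variable whose two roots
are exchanged by mutation (`mul_vieta`). At `x₁ = x₂ = x₃ = 1` it becomes an equation in positive
integers with `M = 3 + k₁ + k₂ + k₃`. The quadratic is nonpositive at the larger of the two other
entries, so exactly one of its roots exceeds both of them (`roots_separated`). Hence every cluster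
is reached by mutations that each create a strict maximum (`IsReachable.isIncreasing`), and a
cluster with a strict maximum can be descended in one way only.

Traces. The parity of a variable is well defined because its order of growth in `x_p` changes under
mutation by an even amount, hence is odd exactly in position `p` (`IsReachable.position_unique`).

Existence. If `ABC = T`, the first row and last column of `T` turn the `(1,2)`-entries of the
children into an exchange relation, so descent of clusters lifts to passage to the parent triple. It
ends at the initial cluster, where the product and the traces leave a single free entry `f`
(`IsMonodromyTriple.eq_initial`).

Uniqueness. Along a tree the middle entry stays the largest. Comparing the sizes of the outer
entries then tells the root (equal) from a left child (first smaller) and a right child (first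
larger); each child map is injective, and the root shows `f` and `σ` (`tree_injective`). -/

namespace CMM

/-! ### Vieta involutions -/

/-- The generalized Markov equation with parameters `M` and `k`. -/
def IsMarkov {R : Type*} [CommRing R] (M : R) (k : Fin 3 → ℕ) (s : Fin 3 → R) : Prop :=
  s 0 ^ 2 + s 1 ^ 2 + s 2 ^ 2 + k 0 * s 1 * s 2 + k 1 * s 0 * s 2 + k 2 * s 0 * s 1 =
    M * s 0 * s 1 * s 2

/-- The Vieta involution of the generalized Markov equation in direction `i`. -/
def vieta {R : Type*} [CommRing R] (M : R) (k : Fin 3 → ℕ) (i : Fin 3) (s : Fin 3 → R) :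
    Fin 3 → R :=
  Function.update s i
    (M * s (i + 1) * s (i + 2) - k (i + 1) * s (i + 2) - k (i + 2) * s (i + 1) - s i)

section Vieta

variable {R : Type*} [CommRing R] {M : R} {k : Fin 3 → ℕ} {s : Fin 3 → R}

theorem add_one_ne (i : Fin 3) : i + 1 ≠ i := by decide +revert

theorem add_two_ne (i : Fin 3) : i + 2 ≠ i := by decide +revert

theorem eq_or_eq_add (i j : Fin 3) : j = i ∨ j = i + 1 ∨ j = i + 2 := by decide +revert

theorem vieta_apply_of_ne {i j : Fin 3} (h : j ≠ i) : vieta M k i s j = s j :=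
  Function.update_of_ne h _ _

theorem vieta_vieta (i : Fin 3) : vieta M k i (vieta M k i s) = s := by
  funext j
  by_cases h : j = i
  · subst h
    simp [vieta]
  · rw [vieta_apply_of_ne h, vieta_apply_of_ne h]

theorem isMarkov_cyclic (h : IsMarkov M k s) (i : Fin 3) :
    s i ^ 2 + s (i + 1) ^ 2 + s (i + 2) ^ 2 + k i * s (i + 1) * s (i + 2) +
      k (i + 1) * s i * s (i + 2) + k (i + 2) * s i * s (i + 1) =
    M * s i * s (i + 1) * s (i + 2) := by
  unfold IsMarkov at h
  fin_cases i <;> simp only [Fin.isValue, Fin.zero_eta, Fin.mk_one, Fin.reduceFinMk, zero_add,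
    Fin.reduceAdd] <;> linear_combination h

/-- Product of the two roots of the Markov equation, read as a quadratic in `s i`; `vieta` is
defined through their sum. This is the exchange relation. -/
theorem mul_vieta (h : IsMarkov M k s) (i : Fin 3) :
    s i * vieta M k i s i =
      s (i + 1) ^ 2 + k i * s (i + 1) * s (i + 2) + s (i + 2) ^ 2 := by
  rw [vieta, Function.update_self]
  linear_combination -isMarkov_cyclic h i

theorem IsMarkov.vieta (h : IsMarkov M k s) (i : Fin 3) : IsMarkov M k (vieta M k i s) := by
  unfold IsMarkov at *
  fin_cases i <;> simp [CMM.vieta, Function.update] <;> linear_combination h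

theorem map_vieta {S : Type*} [CommRing S] (φ : R →+* S) (i : Fin 3) :
    φ ∘ vieta M k i s = vieta (φ M) k i (φ ∘ s) := by
  funext j
  by_cases h : j = i
  · subst h
    simp [vieta]
  · simp [vieta_apply_of_ne h]

end Vieta

/-! ### Positive solutions over the integers -/

section Size

variable {k : Fin 3 → ℕ} {u : Fin 3 → ℤ}

/-- The entry in position `i` is strictly larger than the others. -/
def IsStrictMax (u : Fin 3 → ℤ) (i : Fin 3) : Prop := ∀ j, j ≠ i → u j < u i

theorem isStrictMax_iff {i : Fin 3} : IsStrictMax u i ↔ u (i + 1) < u i ∧ u (i + 2) < u i := by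
  refine ⟨fun h => ⟨h _ (add_one_ne i), h _ (add_two_ne i)⟩, fun h j hj => ?_⟩
  rcases eq_or_eq_add i j with rfl | rfl | rfl
  exacts [absurd rfl hj, h.1, h.2]

theorem IsStrictMax.unique {i j : Fin 3} (hi : IsStrictMax u i) (hj : IsStrictMax u j) :
    i = j := by
  by_contra h
  exact lt_asymm (hi j (Ne.symm h)) (hj i h)

/-- The value at the largest of the two other entries of the quadratic polynomial whose roots
are exchanged by a Vieta involution is nonpositive, and it vanishes only if they are `1`. -/
theorem quadratic_nonpos {p q r b c : ℤ} (hp : 0 ≤ p) (hq : 0 ≤ q) (hr : 0 ≤ r) (hc : 0 < c)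
    (hcb : c ≤ b) :
    b ^ 2 + b * (q * c + r * b - (3 + p + q + r) * b * c) + (b ^ 2 + p * b * c + c ^ 2) ≤ 0 ∧
    (b ^ 2 + b * (q * c + r * b - (3 + p + q + r) * b * c) + (b ^ 2 + p * b * c + c ^ 2) = 0 →
      b = 1 ∧ c = 1) := by
  have hb : 0 < b := hc.trans_le hcb
  have h1 : 0 ≤ b ^ 2 * (c - 1) := mul_nonneg (sq_nonneg b) (by linarith)
  have h2 : 0 ≤ c * (b * b - c) := by
    refine mul_nonneg hc.le ?_
    nlinarith
  have h3 : 0 ≤ b * c * (b - 1) := mul_nonneg (by positivity) (by linarith)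
  -- Since `1 ≤ c ≤ b`, every summand in the bracket is nonnegative; the first two alone force `c =
  -- 1` and `b ^ 2 = c` in the case of equality.
  have e : b ^ 2 + b * (q * c + r * b - (3 + p + q + r) * b * c) + (b ^ 2 + p * b * c + c ^ 2) =
      -(2 * (b ^ 2 * (c - 1)) + c * (b * b - c) + r * (b ^ 2 * (c - 1)) +
        (p + q) * (b * c * (b - 1))) := by ring
  have h4 := mul_nonneg hr h1
  have h5 := mul_nonneg (add_nonneg hp hq) h3
  rw [e]
  refine ⟨by linarith, fun h => ?_⟩
  have h6 : b ^ 2 * (c - 1) = 0 := by linarith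
  have h7 : c * (b * b - c) = 0 := by linarith
  have hc1 : c = 1 := by
    rcases mul_eq_zero.1 h6 with h | h
    · exact absurd h (by positivity)
    · linarith
  subst hc1
  refine ⟨?_, rfl⟩
  nlinarith

/-- The two roots of the quadratic polynomial are separated by the other two entries. -/
theorem roots_separated {p q r b c t t' : ℤ} (hp : 0 ≤ p) (hq : 0 ≤ q) (hr : 0 ≤ r)
    (hb : 0 < b) (hc : 0 < c)
    (hsum : t + t' = (3 + p + q + r) * b * c - q * c - r * b)
    (hprod : t * t' = b ^ 2 + p * b * c + c ^ 2) :
    ¬ ((b < t ∧ c < t) ∧ (b < t' ∧ c < t')) ∧ ((b < t ∧ c < t) ∨ (b < t' ∧ c < t')) := by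
  wlog hcb : c ≤ b generalizing b c q r
  · have := this hr hq hc hb (by linarith) (by linarith) (le_of_not_ge hcb)
    tauto
  have key := quadratic_nonpos hp hq hr hc hcb
  -- The left side is the monic quadratic with roots `t`, `t'`, evaluated at `b = max b c`.
  have e : b ^ 2 + b * (q * c + r * b - (3 + p + q + r) * b * c) + (b ^ 2 + p * b * c + c ^ 2) =
      (t - b) * (t' - b) := by
    linear_combination b * hsum - hprod
  rw [e] at key
  obtain ⟨h1, h2⟩ := key
  constructor
  · rintro ⟨⟨ht, -⟩, ht', -⟩
    nlinarith [mul_pos (sub_pos.2 ht) (sub_pos.2 ht')]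
  · rcases h1.lt_or_eq with h | h
    · rcases mul_neg_iff.1 h with h | h
      · left
        constructor <;> linarith
      · right
        constructor <;> linarith
    -- Here `b = c = 1`, and the roots are `1` and `2 + p`.
    · obtain ⟨rfl, rfl⟩ := h2 h
      rcases mul_eq_zero.1 h with h | h
      · right
        have : t = 1 := by linarith
        subst this
        constructor <;> linarith
      · left
        have : t' = 1 := by linarith
        subst this
        constructor <;> linarith

theorem strictMax_vieta (hu : IsMarkov (3 + k 0 + k 1 + k 2 : ℤ) k u) (hpos : ∀ j, 0 < u j)
    (i : Fin 3) :
    ¬ (IsStrictMax u i ∧ IsStrictMax (vieta (3 + k 0 + k 1 + k 2 : ℤ) k i u) i) ∧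
      (IsStrictMax u i ∨ IsStrictMax (vieta (3 + k 0 + k 1 + k 2 : ℤ) k i u) i) := by
  rw [isStrictMax_iff, isStrictMax_iff, vieta_apply_of_ne (add_one_ne i),
    vieta_apply_of_ne (add_two_ne i)]
  refine roots_separated (p := k i) (q := k (i + 1)) (r := k (i + 2)) (by positivity)
    (by positivity) (by positivity) (hpos _) (hpos _) ?_ (mul_vieta hu i)
  have : (3 + k 0 + k 1 + k 2 : ℤ) = 3 + k i + k (i + 1) + k (i + 2) := by
    fin_cases i <;> simp <;> ring
  rw [vieta, Function.update_self, this]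
  ring

end Size

/-! ### Laurent clusters -/

/-- The triples of Laurent polynomials that are reached from `(x₁, x₂, x₃)` by Vieta
involutions. -/
inductive IsReachable (k : Fin 3 → ℕ) : (Fin 3 → Laurent) → Prop
  | init : IsReachable k x
  | step (s : Fin 3 → Laurent) (i : Fin 3) : IsReachable k s →
      IsReachable k (vieta (markovInvariant k) k i s)

/-- The triples of Laurent polynomials that are reached from `(x₁, x₂, x₃)` by Vieta
involutions that create a strict maximum of the sizes. -/
inductive IsIncreasing (k : Fin 3 → ℕ) : (Fin 3 → Laurent) → Prop
  | init : IsIncreasing k x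
  | step (s : Fin 3 → Laurent) (i : Fin 3) : IsIncreasing k s →
      IsStrictMax (size ∘ vieta (markovInvariant k) k i s) i →
      IsIncreasing k (vieta (markovInvariant k) k i s)

variable {k : Fin 3 → ℕ} {s : Fin 3 → Laurent}

theorem size_x (i : Fin 3) : size (x i) = 1 := by
  simp [size, x, AddMonoidAlgebra.lift_single]

theorem size_xinv (i : Fin 3) : size (xinv i) = 1 := by
  simp [size, xinv, AddMonoidAlgebra.lift_single]

theorem size_markovInvariant : size (markovInvariant k) = 3 + k 0 + k 1 + k 2 := by
  simp [markovInvariant, size_x, size_xinv]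

theorem isMarkov_x : IsMarkov (markovInvariant k) k x := by
  have h0 := x_mul_xinv 0
  have h1 := x_mul_xinv 1
  have h2 := x_mul_xinv 2
  have h : (xinv 0 * xinv 1 * xinv 2) * (x 0 * x 1 * x 2) = 1 := by
    calc _ = (x 0 * xinv 0) * (x 1 * xinv 1) * (x 2 * xinv 2) := by ring
      _ = 1 := by rw [h0, h1, h2]; ring
  unfold IsMarkov markovInvariant
  linear_combination (-(x 0 ^ 2 + x 1 ^ 2 + x 2 ^ 2 +
    k 0 * x 1 * x 2 + k 1 * x 0 * x 2 + k 2 * x 0 * x 1)) * h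

theorem IsReachable.isMarkov (h : IsReachable k s) : IsMarkov (markovInvariant k) k s := by
  induction h with
  | init => exact isMarkov_x
  | step s i _ ih => exact ih.vieta i

theorem IsMarkov.size (h : IsMarkov (markovInvariant k) k s) :
    IsMarkov (3 + k 0 + k 1 + k 2 : ℤ) k (size ∘ s) := by
  have := congrArg CMM.size h
  simp only [map_add, map_mul, map_pow, map_natCast, size_markovInvariant] at this
  exact this

theorem size_vieta (i : Fin 3) :
    size ∘ vieta (markovInvariant k) k i s =
      vieta (3 + k 0 + k 1 + k 2 : ℤ) k i (size ∘ s) := by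
  rw [← size_markovInvariant]
  exact map_vieta size.toRingHom i

/-- In the exchange relation the right side and the old entry are positive, hence so is the new
entry. -/
theorem IsReachable.size_pos (h : IsReachable k s) (j : Fin 3) : 0 < size (s j) := by
  induction h generalizing j with
  | init => simp [size_x]
  | step s i hs ih =>
    by_cases hj : j = i
    · subst hj
      have := congrArg size (mul_vieta hs.isMarkov j)
      simp only [map_mul, map_add, map_pow, map_natCast] at this
      have h1 := ih (j + 1)
      have h2 := ih (j + 2)
      refine pos_of_mul_pos_right ?_ (ih j).le
      rw [this]
      positivity
    · rw [vieta_apply_of_ne hj]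
      exact ih j

theorem IsReachable.ne_zero (h : IsReachable k s) (j : Fin 3) : s j ≠ 0 := by
  intro h0
  have := h.size_pos j
  simp [h0] at this

theorem IsIncreasing.isReachable (h : IsIncreasing k s) : IsReachable k s := by
  induction h with
  | init => exact .init
  | step s i _ _ ih => exact ih.step s i

theorem IsReachable.strictMax_vieta (h : IsReachable k s) (i : Fin 3) :
    ¬ (IsStrictMax (size ∘ s) i ∧ IsStrictMax (size ∘ vieta (markovInvariant k) k i s) i) ∧
      (IsStrictMax (size ∘ s) i ∨ IsStrictMax (size ∘ vieta (markovInvariant k) k i s) i) := by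
  rw [size_vieta]
  exact CMM.strictMax_vieta h.isMarkov.size h.size_pos i

/-- A step that creates no strict maximum starts from a strict maximum in the same position. It
therefore undoes the last step of an increasing path, and the two cancel. -/
theorem IsReachable.isIncreasing (h : IsReachable k s) : IsIncreasing k s := by
  induction h with
  | init => exact .init
  | step s i hs ih =>
    rcases (hs.strictMax_vieta i).2 with h | h
    · cases ih with
      | init =>
        have := h (i + 1) (add_one_ne i)
        simp [size_x] at this
      | step s j hs' hj =>
        obtain rfl := h.unique hj
        rwa [vieta_vieta]
    · exact ih.step s i h

/-! ### Growth along a variable -/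

/-- The evaluation `x_p ↦ exp r` and `x_i ↦ 1` for `i ≠ p`. -/
noncomputable def evalExp (p : Fin 3) (r : ℝ) : Laurent →ₐ[ℤ] ℝ :=
  AddMonoidAlgebra.lift ℤ ℝ (Fin 3 → ℤ)
    { toFun := fun g => Real.exp (r * (g.toAdd p : ℤ))
      map_one' := by simp
      map_mul' := fun g h => by
        rw [← Real.exp_add]
        simp [mul_add] }

theorem evalExp_x (p i : Fin 3) (r : ℝ) :
    evalExp p r (x i) = Real.exp (r * ((Pi.single i 1 : Fin 3 → ℤ) p : ℤ)) := by
  simp [evalExp, x, AddMonoidAlgebra.lift_single]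

/-- The function `f` has the order of growth of `exp (n r)` on `[0, ∞)`. -/
def HasGrowth (f : ℝ → ℝ) (n : ℤ) : Prop :=
  ∃ c > 0, ∃ C > 0, ∀ r ≥ 0, c * Real.exp (r * n) ≤ f r ∧ f r ≤ C * Real.exp (r * n)

theorem HasGrowth.le {f : ℝ → ℝ} {m n : ℤ} (hm : HasGrowth f m) (hn : HasGrowth f n) :
    m ≤ n := by
  by_contra! h
  obtain ⟨c, hc, _, _, h1⟩ := hm
  obtain ⟨_, _, C, hC, h2⟩ := hn
  -- At `r = C / c` the two bounds give `c * exp r ≤ C`, against `exp r ≥ r + 1`.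
  have hr : 0 ≤ C / c := by positivity
  have h3 := (h1 _ hr).1.trans (h2 _ hr).2
  have hmn : (n : ℝ) + 1 ≤ m := by exact_mod_cast h
  have h4 : Real.exp (C / c * n) * Real.exp (C / c) ≤ Real.exp (C / c * m) := by
    rw [← Real.exp_add]
    apply Real.exp_le_exp.2
    nlinarith
  have h5 : c * Real.exp (C / c) ≤ C := by
    have := Real.exp_pos (C / c * n)
    refine le_of_mul_le_mul_right ?_ this
    nlinarith
  have h6 := Real.add_one_le_exp (C / c)
  have h7 : c * (C / c + 1) ≤ C := (mul_le_mul_of_nonneg_left h6 hc.le).trans h5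
  have h8 : c * (C / c + 1) = C + c := by field_simp
  linarith

theorem HasGrowth.unique {f : ℝ → ℝ} {m n : ℤ} (hm : HasGrowth f m) (hn : HasGrowth f n) :
    m = n :=
  le_antisymm (hm.le hn) (hn.le hm)

/-- The order of growth is tropicalized by the exchange relation. -/
theorem HasGrowth.exchange {f f' g h : ℝ → ℝ} {κ : ℕ} {n l m : ℤ} (hf : HasGrowth f n)
    (hg : HasGrowth g l) (hh : HasGrowth h m)
    (e : ∀ r, f r * f' r = g r ^ 2 + κ * g r * h r + h r ^ 2) :
    HasGrowth f' (2 * max l m - n) := by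
  wlog hml : m ≤ l generalizing g h l m
  · rw [max_comm]
    exact this hh hg (fun r => by rw [e]; ring) (le_of_not_ge hml)
  rw [max_eq_left hml]
  obtain ⟨c, hc, C, hC, hf⟩ := hf
  obtain ⟨d, hd, D, hD, hg⟩ := hg
  obtain ⟨a, ha, A, hA, hh⟩ := hh
  refine ⟨d ^ 2 / C, by positivity, (D ^ 2 + κ * D * A + A ^ 2) / c, by positivity,
    fun r hr => ?_⟩
  obtain ⟨f1, f2⟩ := hf r hr
  obtain ⟨g1, g2⟩ := hg r hr
  obtain ⟨h1, h2⟩ := hh r hr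
  have hexp : Real.exp (r * m) ≤ Real.exp (r * l) :=
    Real.exp_le_exp.2 (mul_le_mul_of_nonneg_left (by exact_mod_cast hml) hr)
  have e1 : Real.exp (r * (2 * l - n : ℤ)) * Real.exp (r * n) = Real.exp (r * l) ^ 2 := by
    rw [← Real.exp_add, ← Real.exp_nat_mul]
    push_cast
    ring_nf
  replace h2 : h r ≤ A * Real.exp (r * l) := h2.trans (mul_le_mul_of_nonneg_left hexp hA.le)
  have pn := Real.exp_pos (r * n)
  have pm := Real.exp_pos (r * m)
  have pl := Real.exp_pos (r * l)
  have pk := Real.exp_pos (r * (2 * l - n : ℤ))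
  set En := Real.exp (r * n)
  set El := Real.exp (r * l)
  set Ek := Real.exp (r * (2 * l - n : ℤ))
  have fpos : 0 < f r := (mul_pos hc pn).trans_le f1
  have gpos : 0 < g r := (mul_pos hd pl).trans_le g1
  have hpos : 0 < h r := (mul_pos ha pm).trans_le h1
  have er := e r
  constructor
  · have step : d ^ 2 / C * Ek * f r ≤ f' r * f r := by
      calc d ^ 2 / C * Ek * f r ≤ d ^ 2 / C * Ek * (C * En) := by gcongr
        _ = d ^ 2 * (Ek * En) := by field_simp
        _ = (d * El) ^ 2 := by rw [e1]; ring
        _ ≤ g r ^ 2 := by gcongr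
        _ ≤ f' r * f r := by
          rw [mul_comm, er]
          have : 0 ≤ κ * g r * h r := by positivity
          nlinarith
    exact le_of_mul_le_mul_right step fpos
  · have step : f' r * f r ≤ (D ^ 2 + κ * D * A + A ^ 2) / c * Ek * f r := by
      calc f' r * f r = g r ^ 2 + κ * g r * h r + h r ^ 2 := by rw [mul_comm, er]
        _ ≤ (D * El) ^ 2 + κ * (D * El) * (A * El) + (A * El) ^ 2 := by gcongr
        _ = (D ^ 2 + κ * D * A + A ^ 2) * El ^ 2 := by ring
        _ = (D ^ 2 + κ * D * A + A ^ 2) / c * Ek * (c * En) := by rw [← e1]; field_simp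
        _ ≤ _ := by gcongr
    exact le_of_mul_le_mul_right step fpos

/-- The exponent `n` is replaced by `2 * max l m - n`, so its parity depends only on the position
and can be read off from the initial cluster. -/
theorem IsReachable.hasGrowth (h : IsReachable k s) (p j : Fin 3) :
    ∃ n : ℤ, (Odd n ↔ j = p) ∧ HasGrowth (fun r => evalExp p r (s j)) n := by
  induction h generalizing j with
  | init =>
    refine ⟨(Pi.single j 1 : Fin 3 → ℤ) p, ?_, 1, one_pos, 1, one_pos, fun r _ => ?_⟩
    · rw [Pi.single_apply]
      by_cases hp : j = p
      · simp [hp]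
      · simp [hp, Ne.symm hp]
    · simp [evalExp_x]
  | step s i hs ih =>
    by_cases hj : j = i
    · subst hj
      obtain ⟨n, hn, hf⟩ := ih j
      obtain ⟨l, -, hg⟩ := ih (j + 1)
      obtain ⟨m, -, hh⟩ := ih (j + 2)
      refine ⟨2 * max l m - n, ?_, hf.exchange (κ := k j) hg hh fun r => ?_⟩
      · rw [← hn, Int.odd_sub]
        have h2 : ¬ Odd (2 : ℤ) := by decide
        simp [← Int.not_odd_iff_even, Int.odd_mul, h2]
      · have := congrArg (evalExp p r) (mul_vieta hs.isMarkov j)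
        simpa only [map_mul, map_add, map_pow, map_natCast] using this
    · rw [vieta_apply_of_ne hj]
      exact ih j

/-- A cluster variable appears in one position only. -/
theorem IsReachable.position_unique {t : Fin 3 → Laurent} (hs : IsReachable k s)
    (ht : IsReachable k t) {i j : Fin 3} (h : s i = t j) : i = j := by
  obtain ⟨m, hm, hm'⟩ := hs.hasGrowth i i
  obtain ⟨n, hn, hn'⟩ := ht.hasGrowth i j
  rw [h] at hm'
  obtain rfl := hm'.unique hn'
  exact (hn.1 (hm.2 rfl)).symm

/-! ### Seeds -/

theorem natDegree_exchangePoly (κ : ℕ) :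
    (exchangePoly κ).natDegree = if κ = 0 then 1 else 2 := by
  unfold exchangePoly
  split_ifs <;> compute_degree!

theorem reverse_exchangePoly (κ : ℕ) : (exchangePoly κ).reverse = exchangePoly κ := by
  ext n
  rw [Polynomial.coeff_reverse, natDegree_exchangePoly]
  unfold exchangePoly Polynomial.revAt
  split_ifs <;> rcases n with _ | _ | _ | n <;>
    simp [Polynomial.coeff_one, Polynomial.coeff_X, Polynomial.coeff_X_pow]

/-- Doubling the columns with `k i = 0` compensates for the exchange polynomial having degree `1`
there: degree times entry is `±2` in all cases, whence the squares. -/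
theorem mutate_cluster {S : Seed} {i : Fin 3} (hZ : S.Z i = exchangePoly (k i))
    (hB : S.B = initialB k ∨ S.B = -initialB k) (h0 : ∀ j, S.cluster j ≠ 0) :
    (S.mutate i).cluster i * S.cluster i =
      S.cluster (i + 1) ^ 2 + k i * S.cluster (i + 1) * S.cluster (i + 2) +
        S.cluster (i + 2) ^ 2 := by
  have h1 := h0 0
  have h2 := h0 1
  have h3 := h0 2
  simp only [Seed.mutate, Seed.d, hZ, natDegree_exchangePoly, Function.update_self]
  rcases hB with hB | hB <;> rw [hB] <;> by_cases hk : k i = 0 <;> fin_cases i <;>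
    simp at hk <;>
    simp [initialB, hk, exchangePoly, Fin.prod_univ_three, zpow_ofNat, zpow_neg] <;>
    field_simp <;> ring

/-- Off row and column `i`, a diagonal entry stays `0`, and an off-diagonal one receives minus twice
itself, by the cyclic sign pattern. -/
theorem mutate_B {S : Seed} {i : Fin 3} (hZ : S.Z i = exchangePoly (k i))
    (hB : S.B = initialB k ∨ S.B = -initialB k) : (S.mutate i).B = -S.B := by
  ext a b
  simp only [Seed.mutate, Seed.d, hZ, natDegree_exchangePoly, Matrix.of_apply, Matrix.neg_apply]
  rcases hB with hB | hB <;> rw [hB] <;> fin_cases i <;> fin_cases a <;> fin_cases b <;>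
    simp [initialB] <;> split_ifs <;> simp

theorem IsSeed.exists_isReachable {S : Seed} (h : IsSeed k S) :
    (∃ s, IsReachable k s ∧ S.cluster = algebraMap Laurent RatFun ∘ s) ∧
      (S.B = initialB k ∨ S.B = -initialB k) ∧ ∀ i, S.Z i = exchangePoly (k i) := by
  have inj : Function.Injective (algebraMap Laurent RatFun) :=
    IsFractionRing.injective Laurent RatFun
  induction h with
  | init => exact ⟨⟨x, .init, rfl⟩, .inl rfl, fun i => rfl⟩
  | mutate S i _ ih =>
    obtain ⟨⟨s, hs, hc⟩, hB, hZ⟩ := ih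
    have h0 : ∀ j, S.cluster j ≠ 0 := fun j => by
      rw [hc]
      exact (map_ne_zero_iff _ inj).2 (hs.ne_zero j)
    refine ⟨⟨_, hs.step s i, ?_⟩, ?_, fun j => ?_⟩
    · funext j
      by_cases hj : j = i
      · subst hj
        refine mul_right_cancel₀ (h0 j) ?_
        rw [mutate_cluster (hZ j) hB h0]
        simp only [hc, Function.comp_apply]
        rw [← map_mul, mul_comm (vieta _ _ _ _ _), mul_vieta hs.isMarkov]
        simp
      · simp [Seed.mutate, vieta_apply_of_ne hj, Function.update_of_ne hj, hc]
    · rw [mutate_B (hZ i) hB]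
      rcases hB with h | h <;> simp [h]
    · by_cases hj : j = i
      · subst hj
        simp [Seed.mutate, hZ, reverse_exchangePoly]
      · simp [Seed.mutate, Function.update_of_ne hj, hZ]

theorem IsClusterVariableAt.position_unique {v : Laurent} {i j : Fin 3}
    (h : IsClusterVariableAt k (algebraMap Laurent RatFun v) i) (hs : IsReachable k s)
    (hv : s j = v) : i = j := by
  obtain ⟨S, hS, h⟩ := h
  obtain ⟨⟨t, ht, hc⟩, -⟩ := hS.exists_isReachable
  rw [hc] at h
  have := IsFractionRing.injective Laurent RatFun h
  exact ht.position_unique hs (this.trans hv.symm)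

/-! ### Mutation of matrix triples -/

variable {A B C : SL2}

theorem SL2_inv_val (A : SL2) : (A⁻¹).val = !![A 1 1, -A 0 1; -A 1 0, A 0 0] := by
  rw [Matrix.SpecialLinearGroup.coe_inv, Matrix.adjugate_fin_two]

theorem SL2_det (A : SL2) : A 0 0 * A 1 1 - A 0 1 * A 1 0 = 1 := by
  rw [← Matrix.det_fin_two, A.det_coe]

/-- The first row of `A * B = T * C⁻¹`. -/
theorem first_row_mul (h : A.val * B.val * C.val = T k) :
    A 0 0 * B 0 0 + A 0 1 * B 1 0 = -C 1 1 ∧ A 0 0 * B 0 1 + A 0 1 * B 1 1 = C 0 1 := by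
  have h' : A.val * B.val = T k * (C⁻¹).val :=
    (congrArg Subtype.val (mul_inv_cancel_right (A * B) C).symm).trans
      (congrArg (fun N => N * (C⁻¹).val) h)
  rw [SL2_inv_val] at h'
  have h1 := congrFun (congrFun h' 0) 0
  have h2 := congrFun (congrFun h' 0) 1
  simp [T, Matrix.mul_apply, Fin.sum_univ_two] at h1 h2
  exact ⟨h1, h2⟩

/-- The last column of `B * C = A⁻¹ * T`. -/
theorem last_column_mul (h : A.val * B.val * C.val = T k) :
    B 0 0 * C 0 1 + B 0 1 * C 1 1 = A 0 1 ∧ B 1 0 * C 0 1 + B 1 1 * C 1 1 = -A 0 0 := by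
  have h' : B.val * C.val = (A⁻¹).val * T k :=
    (congrArg Subtype.val (show B * C = A⁻¹ * (A * B * C) by group)).trans
      (congrArg (fun N => (A⁻¹).val * N) h)
  rw [SL2_inv_val] at h'
  have h1 := congrFun (congrFun h' 0) 1
  have h2 := congrFun (congrFun h' 1) 1
  simp [T, Matrix.mul_apply, Fin.sum_univ_two] at h1 h2
  exact ⟨h1, h2⟩

/-- The last column of `T` is `(0, -1)`, so the `(1,2)`-entry of `B * C` is that of `A`; the Markov
invariant plays no role. -/
theorem left_child_entry (h : A.val * B.val * C.val = T k) :
    (B * C * B⁻¹) 0 1 * C 0 1 = A 0 1 ^ 2 - C.val.trace * A 0 1 * B 0 1 + B 0 1 ^ 2 := by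
  obtain ⟨h1, h2⟩ := last_column_mul h
  have hC := SL2_det C
  have e : (B * C * B⁻¹) 0 1 =
      -(B 0 0 * C 0 0 + B 0 1 * C 1 0) * B 0 1 + (B 0 0 * C 0 1 + B 0 1 * C 1 1) * B 0 0 := by
    change (B.val * C.val * (B⁻¹).val) 0 1 = _
    rw [SL2_inv_val]
    simp only [Matrix.mul_apply, Fin.sum_univ_two, Matrix.of_apply, Matrix.cons_val_zero,
      Matrix.cons_val_one]
    ring
  rw [e, Matrix.trace_fin_two, ← h1]
  linear_combination B 0 1 ^ 2 * hC

theorem right_child_entry (h : A.val * B.val * C.val = T k) :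
    (B⁻¹ * A * B) 0 1 * A 0 1 = B 0 1 ^ 2 - A.val.trace * B 0 1 * C 0 1 + C 0 1 ^ 2 := by
  obtain ⟨h1, h2⟩ := first_row_mul h
  have hA := SL2_det A
  have e : (B⁻¹ * A * B) 0 1 =
      B 1 1 * (A 0 0 * B 0 1 + A 0 1 * B 1 1) - B 0 1 * (A 1 0 * B 0 1 + A 1 1 * B 1 1) := by
    change ((B⁻¹).val * A.val * B.val) 0 1 = _
    rw [SL2_inv_val]
    simp only [Matrix.mul_apply, Fin.sum_univ_two, Matrix.of_apply, Matrix.cons_val_zero,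
      Matrix.cons_val_one]
    ring
  rw [e, Matrix.trace_fin_two, ← h2]
  linear_combination B 0 1 ^ 2 * hA

theorem trace_conj (A B : SL2) : (A * B * A⁻¹).val.trace = B.val.trace := by
  rw [Matrix.SpecialLinearGroup.coe_mul, Matrix.trace_mul_comm,
    ← Matrix.SpecialLinearGroup.coe_mul]
  simp

theorem trace_conj' (A B : SL2) : (A⁻¹ * B * A).val.trace = B.val.trace := by
  simpa using trace_conj A⁻¹ B

/-- The triple `v` has product `T`, the `(1,2)`-entries `s i` and the traces `-κ i`. -/
structure IsMonodromyTriple (k κ : Fin 3 → ℕ) (s : Fin 3 → Laurent) (v : SL2 × SL2 × SL2) :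
    Prop where
  prod_eq : v.1.val * v.2.1.val * v.2.2.val = T k
  entry₀ : v.1 0 1 = s 0
  entry₁ : v.2.1 0 1 = s 1
  entry₂ : v.2.2 0 1 = s 2
  trace₀ : v.1.val.trace = -(κ 0 : Laurent)
  trace₁ : v.2.1.val.trace = -(κ 1 : Laurent)
  trace₂ : v.2.2.val.trace = -(κ 2 : Laurent)

/-- The children are braid moves, which preserve the product. -/
theorem child_product (d : Direction) (v : SL2 × SL2 × SL2) :
    (child d v).1 * (child d v).2.1 * (child d v).2.2 = v.1 * v.2.1 * v.2.2 := by
  obtain ⟨A, B, C⟩ := v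
  cases d <;> simp [child, mul_assoc]

theorem prod_of_child {d : Direction} {v : SL2 × SL2 × SL2}
    (hp : (child d v).1.val * (child d v).2.1.val * (child d v).2.2.val = T k) :
    v.1.val * v.2.1.val * v.2.2.val = T k :=
  (congrArg Subtype.val (child_product d v)).symm.trans hp

theorem child_injective (d : Direction) : Function.Injective (child d) := by
  rintro ⟨A, B, C⟩ ⟨A', B', C'⟩ h
  cases d
  · simp only [child, Prod.mk.injEq] at h
    obtain ⟨rfl, h, rfl⟩ := h
    simpa using h
  · simp only [child, Prod.mk.injEq] at h
    obtain ⟨rfl, h, rfl⟩ := h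
    simpa using h

theorem root_eq_child (k : Fin 3 → ℕ) (σ : Equiv.Perm (Fin 3)) (f : Laurent) :
    root k σ f = child .left (X k (σ * Equiv.swap 1 2) f, Y k (σ * Equiv.swap 1 2) f,
      Z k (σ * Equiv.swap 1 2) f) := rfl

/-! ### Existence -/

theorem SL2_ext_of_entry {i : Fin 3} (h01 : A 0 1 = x i) {p q : Laurent} (h00 : A 0 0 = p)
    (h11 : A 1 1 = q) : A = matOf p i q := by
  have h := SL2_det A
  refine Subtype.ext (Matrix.ext fun a b => ?_)
  fin_cases a <;> fin_cases b
  · exact h00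
  · exact h01
  · change A 1 0 = (p * q - 1) * xinv i
    rw [h00, h01, h11] at h
    linear_combination (-A 1 0) * x_mul_xinv i - xinv i * h
  · exact h11

/-- A triple at the initial cluster is `(X_τ(f), Y_τ(f), Z_τ(f))`. -/
theorem IsMonodromyTriple.eq_initial {τ : Equiv.Perm (Fin 3)}
    (h : IsMonodromyTriple k (k ∘ τ) (x ∘ τ) (A, B, C)) :
    (A, B, C) = (X k τ (A 0 0), Y k τ (A 0 0), Z k τ (A 0 0)) := by
  obtain ⟨hp, ha, hb, hc, ta, tb, tc⟩ := h
  simp only [Function.comp_apply] at *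
  have h1 := (first_row_mul hp).2
  have h2 := (last_column_mul hp).1
  rw [Matrix.trace_fin_two] at ta tb tc
  have x0 := x_mul_xinv (τ 0)
  have x1 := x_mul_xinv (τ 1)
  rw [ha, hb, hc] at h1
  rw [ha, hb, hc] at h2
  -- With `f = A 0 0` free, the first row gives `B 1 1`, the last column gives `C 1 1`, and the
  -- traces give the remaining diagonal entries.
  have eB11 : B 1 1 = (-A 0 0 * x (τ 1) + x (τ 2)) * xinv (τ 0) := by
    linear_combination xinv (τ 0) * h1 - B 1 1 * x0
  have eB00 : B 0 0 = (A 0 0 * x (τ 1) - k (τ 1) * x (τ 0) - x (τ 2)) * xinv (τ 0) := by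
    linear_combination tb - eB11 + k (τ 1) * x0
  have eC11 : C 1 1 = (-A 0 0 * x (τ 1) * x (τ 2) + k (τ 1) * x (τ 0) * x (τ 2) + x (τ 0) ^ 2 +
      x (τ 2) ^ 2) * (xinv (τ 0) * xinv (τ 1)) := by
    rw [eB00] at h2
    linear_combination xinv (τ 1) * h2 - C 1 1 * x1 - xinv (τ 1) * x (τ 0) * x0
  have eC00 : C 0 0 = (A 0 0 * x (τ 1) * x (τ 2) - k (τ 2) * x (τ 0) * x (τ 1) -
      k (τ 1) * x (τ 0) * x (τ 2) - x (τ 0) ^ 2 - x (τ 2) ^ 2) * (xinv (τ 0) * xinv (τ 1)) := by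
    linear_combination tc - eC11 + k (τ 2) * (x (τ 0) * xinv (τ 0) * x1 + x0)
  refine Prod.ext (SL2_ext_of_entry ha rfl ?_) (Prod.ext (SL2_ext_of_entry hb eB00 eB11)
    (SL2_ext_of_entry hc eC00 eC11))
  linear_combination ta

theorem perm_cyclic (τ : Equiv.Perm (Fin 3)) :
    (τ 0 = τ 1 + 1 ∧ τ 2 = τ 1 + 2) ∨ (τ 2 = τ 1 + 1 ∧ τ 0 = τ 1 + 2) := by
  decide +revert

theorem mul_vieta_perm {s : Fin 3 → Laurent} (hs : IsMarkov (markovInvariant k) k s)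
    (τ : Equiv.Perm (Fin 3)) :
    s (τ 1) * vieta (markovInvariant k) k (τ 1) s (τ 1) =
      s (τ 0) ^ 2 + k (τ 1) * s (τ 0) * s (τ 2) + s (τ 2) ^ 2 := by
  rw [mul_vieta hs]
  rcases perm_cyclic τ with ⟨h0, h2⟩ | ⟨h2, h0⟩ <;> rw [h0, h2]
  ring

theorem perm_ne (τ : Equiv.Perm (Fin 3)) : τ 0 ≠ τ 1 ∧ τ 2 ≠ τ 1 :=
  ⟨τ.injective.ne (by decide), τ.injective.ne (by decide)⟩

/-- The parent of a triple with respect to the left children. -/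
theorem IsMonodromyTriple.parent_left {s : Fin 3 → Laurent} (hs : IsReachable k s)
    {τ : Equiv.Perm (Fin 3)}
    (h : IsMonodromyTriple k (k ∘ τ) (vieta (markovInvariant k) k (τ 1) s ∘ τ) (A, B, C)) :
    IsMonodromyTriple k (k ∘ (τ * Equiv.swap 1 2 : Equiv.Perm (Fin 3)))
      (s ∘ (τ * Equiv.swap 1 2 : Equiv.Perm (Fin 3))) (A, C, C⁻¹ * B * C) := by
  obtain ⟨n0, n2⟩ := perm_ne τ
  obtain ⟨hp, ha, hb, hc, ta, tb, tc⟩ := h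
  simp only [Function.comp_apply, vieta_apply_of_ne n0, vieta_apply_of_ne n2] at ha hb hc ta tb tc
  have hp' : A.val * C.val * (C⁻¹ * B * C).val = T k :=
    (congrArg Subtype.val (show A * C * (C⁻¹ * B * C) = A * B * C by group)).trans hp
  refine ⟨hp', ha, hc, ?_, ta, tc, (trace_conj' C B).trans tb⟩
  have e := left_child_entry hp'
  rw [trace_conj', tb, show C * (C⁻¹ * B * C) * C⁻¹ = B by group, ha, hb, hc] at e
  have h0 := (hs.step s (τ 1)).ne_zero (τ 1)
  -- The unknown entry and `s (τ 1)` have the same product with the nonzero mutated entry.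
  refine mul_left_cancel₀ h0 (e.trans ?_)
  simp only [Function.comp_apply, Equiv.Perm.mul_apply, Equiv.swap_apply_right]
  linear_combination -mul_vieta_perm hs.isMarkov τ

/-- The parent of a triple with respect to the right children. -/
theorem IsMonodromyTriple.parent_right {s : Fin 3 → Laurent} (hs : IsReachable k s)
    {τ : Equiv.Perm (Fin 3)}
    (h : IsMonodromyTriple k (k ∘ τ) (vieta (markovInvariant k) k (τ 1) s ∘ τ) (A, B, C)) :
    IsMonodromyTriple k (k ∘ (τ * Equiv.swap 0 1 : Equiv.Perm (Fin 3)))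
      (s ∘ (τ * Equiv.swap 0 1 : Equiv.Perm (Fin 3))) (A * B * A⁻¹, A, C) := by
  obtain ⟨n0, n2⟩ := perm_ne τ
  obtain ⟨hp, ha, hb, hc, ta, tb, tc⟩ := h
  simp only [Function.comp_apply, vieta_apply_of_ne n0, vieta_apply_of_ne n2] at ha hb hc ta tb tc
  have hp' : (A * B * A⁻¹).val * A.val * C.val = T k :=
    (congrArg Subtype.val (show A * B * A⁻¹ * A * C = A * B * C by group)).trans hp
  refine ⟨hp', ?_, ha, hc, (trace_conj A B).trans tb, ta, tc⟩
  have e := right_child_entry hp'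
  rw [trace_conj, tb, show A⁻¹ * (A * B * A⁻¹) * A = B by group, ha, hb, hc] at e
  have h0 := (hs.step s (τ 1)).ne_zero (τ 1)
  refine mul_left_cancel₀ h0 (e.trans ?_)
  simp only [Function.comp_apply, Equiv.Perm.mul_apply, Equiv.swap_apply_left]
  linear_combination -mul_vieta_perm hs.isMarkov τ

theorem IsMonodromyTriple.exists_tree_eq {s : Fin 3 → Laurent} (hs : IsIncreasing k s)
    {τ : Equiv.Perm (Fin 3)}
    (hτ : IsStrictMax (size ∘ vieta (markovInvariant k) k (τ 1) s) (τ 1))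
    (h : IsMonodromyTriple k (k ∘ τ) (vieta (markovInvariant k) k (τ 1) s ∘ τ) (A, B, C)) :
    ∃ f σ v, tree k σ f v = (A, B, C) := by
  induction hs generalizing τ A B C with
  | init =>
    -- The parent lies over the initial cluster, and its left child is by definition the root.
    refine ⟨A 0 0, τ, [], ?_⟩
    have := (h.parent_left .init).eq_initial
    rw [tree, root_eq_child, ← this]
    simp [child, mul_assoc]
  | step s j hs hj ih =>
    have hr := hs.isReachable.step s j
    -- Two successive steps in one direction cannot both create a strict maximum. So the largest
    -- entry of the parent is one of the outer matrices, and its side decides which parent to take.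
    have hne : j ≠ τ 1 := by
      rintro rfl
      exact (hr.strictMax_vieta (τ 1)).1 ⟨hj, hτ⟩
    have hcases : j = τ 0 ∨ j = τ 2 := by
      obtain ⟨l, rfl⟩ := τ.surjective j
      fin_cases l
      exacts [.inl rfl, absurd rfl hne, .inr rfl]
    rcases hcases with rfl | rfl
    · have h' := h.parent_right hr
      have e : (τ * Equiv.swap 0 1 : Equiv.Perm (Fin 3)) 1 = τ 0 := by simp
      rw [← e] at hj h'
      obtain ⟨f, σ, v, hv⟩ := ih hj h'
      refine ⟨f, σ, .right :: v, ?_⟩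
      rw [tree, hv]
      simp [child, mul_assoc]
    · have h' := h.parent_left hr
      have e : (τ * Equiv.swap 1 2 : Equiv.Perm (Fin 3)) 1 = τ 2 := by simp
      rw [← e] at hj h'
      obtain ⟨f, σ, v, hv⟩ := ih hj h'
      refine ⟨f, σ, .left :: v, ?_⟩
      rw [tree, hv]
      simp [child, mul_assoc]

theorem IsCMMMatrix.trace_eq {s : Fin 3 → Laurent} (h : IsCMMMatrix k A) (hs : IsReachable k s)
    {j : Fin 3} (hj : A 0 1 = s j) : A.val.trace = -(k j : Laurent) := by
  obtain ⟨-, κ, ⟨i, hi, rfl⟩, ht⟩ := h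
  rw [ht, hi.position_unique hs hj.symm]

theorem IsCMMTriple.exists_isMonodromyTriple (h : IsCMMTriple k A B C) :
    ∃ (s : Fin 3 → Laurent) (τ : Equiv.Perm (Fin 3)), IsReachable k s ∧ IsMonodromyTriple k (k ∘ τ) (s ∘ τ) (A, B, C) := by
  obtain ⟨hA, hB, hC, hp, S, hS, τ, hτ⟩ := h
  obtain ⟨⟨s, hs, hc⟩, -⟩ := hS.exists_isReachable
  have inj : Function.Injective (algebraMap Laurent RatFun) :=
    IsFractionRing.injective Laurent RatFun
  rw [hc] at hτ
  have h0 := inj (congrFun hτ 0)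
  have h1 := inj (congrFun hτ 1)
  have h2 := inj (congrFun hτ 2)
  exact ⟨s, τ, hs, hp, h0, h1, h2, hA.trace_eq hs h0, hB.trace_eq hs h1, hC.trace_eq hs h2⟩

theorem IsCMMTriple.exists_tree_eq (h : IsCMMTriple k A B C)
    (hb : max (size (A 0 1)) (size (C 0 1)) < size (B 0 1)) :
    ∃ f σ v, tree k σ f v = (A, B, C) := by
  obtain ⟨s, τ, hs, h⟩ := h.exists_isMonodromyTriple
  have hmax : IsStrictMax (size ∘ s) (τ 1) := by
    intro j hj
    have h0 := h.entry₀
    have h1 := h.entry₁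
    have h2 := h.entry₂
    simp only [Function.comp_apply] at *
    rw [h0, h1, h2, max_lt_iff] at hb
    obtain ⟨l, rfl⟩ := τ.surjective j
    fin_cases l
    exacts [hb.1, absurd rfl hj, hb.2]
  cases hs.isIncreasing with
  | init =>
    have := hmax (τ 1 + 1) (add_one_ne _)
    simp [size_x] at this
  | step s i hs' hi =>
    obtain rfl := hmax.unique hi
    exact h.exists_tree_eq hs' hmax

/-! ### Uniqueness -/

/-- The middle entry of a triple is the largest, and the traces are nonpositive integers. -/
structure IsDominated (v : SL2 × SL2 × SL2) : Prop where
  pos₀ : 0 < size (v.1 0 1)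
  pos₂ : 0 < size (v.2.2 0 1)
  lt₀ : size (v.1 0 1) < size (v.2.1 0 1)
  lt₂ : size (v.2.2 0 1) < size (v.2.1 0 1)
  trace₀ : size v.1.val.trace ≤ 0
  trace₁ : size v.2.1.val.trace ≤ 0
  trace₂ : size v.2.2.val.trace ≤ 0

/-- `m * c ≥ a ^ 2 + b ^ 2 > b ^ 2 ≥ b * c`. -/
theorem lt_of_exchange {a b c m t : ℤ} (ha : 0 < a) (hb : 0 < b) (hc : 0 < c) (ht : t ≤ 0)
    (hcb : c ≤ b) (h : m * c = a ^ 2 - t * a * b + b ^ 2) : b < m := by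
  have h1 : 0 ≤ (-t) * (a * b) := mul_nonneg (by linarith) (by positivity)
  have h2 : b * c ≤ b * b := mul_le_mul_of_nonneg_left hcb hb.le
  have h3 : 0 < a ^ 2 := by positivity
  refine lt_of_mul_lt_mul_right ?_ hc.le
  linarith

theorem size_left_child_entry (h : A.val * B.val * C.val = T k) :
    size ((B * C * B⁻¹) 0 1) * size (C 0 1) = size (A 0 1) ^ 2 -
      size C.val.trace * size (A 0 1) * size (B 0 1) + size (B 0 1) ^ 2 := by
  simpa only [map_mul, map_add, map_sub, map_pow] using congrArg size (left_child_entry h)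

theorem size_right_child_entry (h : A.val * B.val * C.val = T k) :
    size ((B⁻¹ * A * B) 0 1) * size (A 0 1) = size (B 0 1) ^ 2 -
      size A.val.trace * size (B 0 1) * size (C 0 1) + size (C 0 1) ^ 2 := by
  simpa only [map_mul, map_add, map_sub, map_pow] using congrArg size (right_child_entry h)

theorem isDominated_left_child (hp : A.val * B.val * C.val = T k) (pa : 0 < size (A 0 1))
    (pc : 0 < size (C 0 1)) (la : size (A 0 1) ≤ size (B 0 1))
    (lc : size (C 0 1) ≤ size (B 0 1)) (ta : size A.val.trace ≤ 0) (tb : size B.val.trace ≤ 0)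
    (tc : size C.val.trace ≤ 0) : IsDominated (child .left (A, B, C)) := by
  have pb := pa.trans_le la
  have := lt_of_exchange pa pb pc tc lc (size_left_child_entry hp)
  exact ⟨pa, pb, la.trans_lt this, this, ta, (congrArg size (trace_conj B C)).trans_le tc, tb⟩

theorem isDominated_right_child (hp : A.val * B.val * C.val = T k) (pa : 0 < size (A 0 1))
    (pc : 0 < size (C 0 1)) (la : size (A 0 1) ≤ size (B 0 1))
    (lc : size (C 0 1) ≤ size (B 0 1)) (ta : size A.val.trace ≤ 0) (tb : size B.val.trace ≤ 0)
    (tc : size C.val.trace ≤ 0) : IsDominated (child .right (A, B, C)) := by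
  have pb := pa.trans_le la
  have e := size_right_child_entry hp
  have := lt_of_exchange pc pb pa ta la (e.trans (by ring : _ = size (C 0 1) ^ 2 -
    size A.val.trace * size (C 0 1) * size (B 0 1) + size (B 0 1) ^ 2))
  exact ⟨pb, pc, this, lc.trans_lt this, tb, (congrArg size (trace_conj' B A)).trans_le ta, tc⟩

theorem IsDominated.child {v : SL2 × SL2 × SL2} (h : IsDominated v)
    (hp : v.1.val * v.2.1.val * v.2.2.val = T k) (d : Direction) : IsDominated (child d v) := by
  obtain ⟨pa, pc, la, lc, ta, tb, tc⟩ := h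
  cases d
  exacts [isDominated_left_child hp pa pc la.le lc.le ta tb tc,
    isDominated_right_child hp pa pc la.le lc.le ta tb tc]

theorem matOf_trace (p : Laurent) (i : Fin 3) (q : Laurent) : (matOf p i q).val.trace = p + q :=
  Matrix.trace_fin_two_of _ _ _ _

theorem size_trace_X (σ : Equiv.Perm (Fin 3)) (f : Laurent) :
    size (X k σ f).val.trace ≤ 0 := by
  rw [X, matOf_trace]
  simp only [map_add, map_sub, map_neg, map_natCast]
  linarith [Int.natCast_nonneg (k (σ 0))]

theorem size_trace_Y (σ : Equiv.Perm (Fin 3)) (f : Laurent) :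
    size (Y k σ f).val.trace ≤ 0 := by
  simp [Y, matOf_trace, size_x, size_xinv]

theorem size_trace_Z (σ : Equiv.Perm (Fin 3)) (f : Laurent) :
    size (Z k σ f).val.trace ≤ 0 := by
  rw [Z, matOf_trace]
  simp only [map_add, map_mul, map_sub, map_pow, map_neg, map_natCast, size_x, size_xinv]
  linarith [Int.natCast_nonneg (k (σ 2))]

theorem isDominated_left_child_initial {τ : Equiv.Perm (Fin 3)} {f : Laurent}
    (hp : (X k τ f).val * (Y k τ f).val * (Z k τ f).val = T k) :
    IsDominated (child .left (X k τ f, Y k τ f, Z k τ f)) := by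
  have hX : size (X k τ f 0 1) = 1 := size_x _
  have hY : size (Y k τ f 0 1) = 1 := size_x _
  have hZ : size (Z k τ f 0 1) = 1 := size_x _
  exact isDominated_left_child hp (hX ▸ one_pos) (hZ ▸ one_pos) (hX.trans hY.symm).le
    (hZ.trans hY.symm).le (size_trace_X _ f) (size_trace_Y _ f) (size_trace_Z _ f)

theorem isDominated_root {σ : Equiv.Perm (Fin 3)} {f : Laurent}
    (hp : (root k σ f).1.val * (root k σ f).2.1.val * (root k σ f).2.2.val = T k) :
    IsDominated (root k σ f) := by
  rw [root_eq_child] at hp ⊢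
  have hp' := prod_of_child hp
  exact isDominated_left_child_initial hp'

/-- Products agree along the tree, so the product hypothesis at one vertex passes up to the root and
the product of the root need not be computed. -/
theorem isDominated_tree {σ : Equiv.Perm (Fin 3)} {f : Laurent} (w : List Direction)
    (hp : (tree k σ f w).1.val * (tree k σ f w).2.1.val * (tree k σ f w).2.2.val = T k) :
    IsDominated (tree k σ f w) := by
  induction w with
  | nil => exact isDominated_root hp
  | cons d w ih => exact (ih (prod_of_child hp)).child (prod_of_child hp) d

theorem size_root (σ : Equiv.Perm (Fin 3)) (f : Laurent) :
    size ((root k σ f).1 0 1) = size ((root k σ f).2.2 0 1) :=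
  (size_x _).trans (size_x _).symm

theorem IsDominated.child_left_lt {v : SL2 × SL2 × SL2} (h : IsDominated v) :
    size ((CMM.child .left v).1 0 1) < size ((CMM.child .left v).2.2 0 1) := h.lt₀

theorem IsDominated.child_right_lt {v : SL2 × SL2 × SL2} (h : IsDominated v) :
    size ((CMM.child .right v).2.2 0 1) < size ((CMM.child .right v).1 0 1) := h.lt₂

theorem size_child_ne {d : Direction} {v : SL2 × SL2 × SL2} (h : IsDominated v) :
    size ((CMM.child d v).1 0 1) ≠ size ((CMM.child d v).2.2 0 1) := by
  cases d
  exacts [h.child_left_lt.ne, h.child_right_lt.ne']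

/-- An instance of uniqueness of positions; the value of `k` is immaterial. -/
theorem x_injective : Function.Injective x := fun i j h => by
  have h := IsReachable.init (k := 0).position_unique .init h
  exact h

theorem perm_ext {σ σ' : Equiv.Perm (Fin 3)} (h0 : σ 0 = σ' 0) (h2 : σ 2 = σ' 2) : σ = σ' := by
  decide +revert

theorem root_injective {σ σ' : Equiv.Perm (Fin 3)} {f f' : Laurent}
    (h : root k σ f = root k σ' f') : f = f' ∧ σ = σ' := by
  have h1 : X k (σ * Equiv.swap 1 2) f = X k (σ' * Equiv.swap 1 2) f' := congrArg Prod.fst h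
  have h2 : Y k (σ * Equiv.swap 1 2) f = Y k (σ' * Equiv.swap 1 2) f' :=
    congrArg (fun v => v.2.2) h
  refine ⟨congrArg (fun A : SL2 => A 0 0) h1, perm_ext ?_ ?_⟩
  · have := x_injective (congrArg (fun A : SL2 => A 0 1) h1)
    simpa [Equiv.swap_apply_def] using this
  · have := x_injective (congrArg (fun A : SL2 => A 0 1) h2)
    simpa using this

theorem tree_injective {σ σ' : Equiv.Perm (Fin 3)} {f f' : Laurent} {w w' : List Direction}
    (h : tree k σ f w = tree k σ' f' w')
    (hp : (tree k σ f w).1.val * (tree k σ f w).2.1.val * (tree k σ f w).2.2.val = T k) :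
    f = f' ∧ σ = σ' ∧ w = w' := by
  induction w generalizing w' with
  | nil =>
    cases w' with
    | nil => exact ⟨(root_injective h).1, (root_injective h).2, rfl⟩
    | cons d w' =>
      rw [h] at hp
      have := size_child_ne (d := d) (isDominated_tree w' (prod_of_child hp))
      change root k σ f = child d _ at h
      exact absurd (size_root σ f) (h ▸ this)
  | cons d w ih =>
    have hw := isDominated_tree w (prod_of_child hp)
    cases w' with
    | nil =>
      have := size_child_ne (d := d) hw
      change child d _ = root k σ' f' at h
      exact absurd (size_root σ' f') (h ▸ this)
    | cons d' w' =>
      have hp' := hp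
      rw [h] at hp'
      have hw' := isDominated_tree w' (prod_of_child hp')
      change child d _ = child d' _ at h
      -- The larger outer entry is the middle entry of the parent: it stands last in a left child
      -- and first in a right child.
      have hd : d = d' := by
        have l := hw.child_left_lt
        have r := hw.child_right_lt
        have l' := hw'.child_left_lt
        have r' := hw'.child_right_lt
        cases d <;> cases d'
        · rfl
        · rw [h] at l
          exact absurd l r'.asymm
        · rw [h] at r
          exact absurd r l'.asymm
        · rfl
      subst hd
      obtain ⟨hf, hσ, rfl⟩ := ih (child_injective d h) (prod_of_child hp)
      exact ⟨hf, hσ, rfl⟩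

end CMM

/-! ### Existence and uniqueness combined. -/

theorem mainTheorem6 (k : Fin 3 → ℕ) (X Y Z : CMM.SL2) (a b c : CMM.Laurent)
    (hXYZ : CMM.IsCMMTriple k X Y Z) (habc : CMM.IsAssociated X Y Z a b c)
    (hb : max (CMM.size a) (CMM.size c) < CMM.size b) :
    ∃! v : CMM.Laurent × Equiv.Perm (Fin 3) × List CMM.Direction,
      CMM.tree k v.2.1 v.1 v.2.2 = (X, Y, Z) := by
  obtain ⟨rfl, rfl, rfl⟩ := habc
  obtain ⟨f, σ, w, h⟩ := hXYZ.exists_tree_eq hb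
  refine ⟨(f, σ, w), h, ?_⟩
  rintro ⟨f', σ', w'⟩ h'
  have hp := hXYZ.prod_eq
  obtain ⟨rfl, rfl, rfl⟩ := CMM.tree_injective (h.trans h'.symm) (by rw [h]; exact hp)
  rfl
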